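/- For integers $d\ge 1$ and $n\ge 0$, let the book graph $B_{d,n}$ be the graph obtained from the complete graph $K_d$ by adding $n$ pairwise nonadjacent vertices, each adjacent to every vertex of $K_d$. For a finite graph $G$, the hat-guessing number $\mathrm{HG}(G)$ is the largest integer $q$ for which the players win the following game: one player sits at each vertex, each gets a hat of one of $q$ colors, each player sees exactly the hats of the players at adjacent vertices, and, by a strategy fixed in advance (the guess at each vertex is a function of the colors on its neighbors), all players simultaneously guess their own hat color; the players win if for every assignment of hats at least one player guesses correctly. **Theorem.** For every $d\ge 1$ there is $N=N(d)$ such that for all $n\ge N$, $$\mathrm{HG}(B_{d,n}) = 1+\sum_{i=1}^{d} i^i ,$$ and moreover the minimum size $\tau(B_{d,n})$ of a vertex cover of $B_{d,n}$ equals $d$. In particular, the value $1+\sum_{i=1}^{\tau(G)} i^i$ of Gadouleau's upper bound for $\mathrm{HG}(G)$ is attained by a graph $G$ with $\tau(G)=d$, for every $d\ge1$. -/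

import Mathlib

/-- The book graph `B_{d,n}`: a clique on the spine `Fin d`, together with `n` pages `Fin n`,
pairwise nonadjacent and each adjacent to every spine vertex. -/
def bookGraph (d n : ℕ) : SimpleGraph (Fin d ⊕ Fin n) where
  Adj u v := u ≠ v ∧ (u.isLeft = true ∨ v.isLeft = true)
  symm := ⟨fun _ _ h => ⟨h.1.symm, h.2.symm⟩⟩
  loopless := ⟨fun _ h => h.1 rfl⟩

/-- A guessing strategy with `q` hat colours: the player at `v` guesses a colour as a function of
the colours of the hats at the neighbours of `v` only. -/
abbrev HatStrategy {V : Type*} (G : SimpleGraph V) (q : ℕ) : Type _ :=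
  (v : V) → (G.neighborSet v → Fin q) → Fin q

/-- The players on `G` can guarantee a win with `q` colours: some strategy makes at least one
player guess correctly, whatever the assignment of hats. -/
def HatWinnable {V : Type*} (G : SimpleGraph V) (q : ℕ) : Prop :=
  ∃ f : HatStrategy G q, ∀ c : V → Fin q, ∃ v : V, f v (fun w => c w) = c v

/-- `q` is the hat-guessing number of `G`: the largest number of colours for which the players
can guarantee a win. -/
def IsHatGuessingNumber {V : Type*} (G : SimpleGraph V) (q : ℕ) : Prop :=
  IsGreatest {k : ℕ | HatWinnable G k} q

/-!
Suppose that there are so many pages that every function of the spine colouring is the guess of one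
of them. The pages can then be coloured so that fewer than `q` spine colourings remain for the
spine, and the wrong guesses of the pages can leave any such set. Hence `q` colours suffice for a
win if and only if the spine can guess every set `T` of fewer than `q` points of `(Fin q)^d`.

Write `π_i` for the projection which forgets the `i`-th coordinate. The guesses of the `i`-th player
are indexed by the points of `π_i T`, and each of them serves one point of `T`; so by Hall's theorem
`T` can be guessed if and only if `|S| ≤ ∑ i, |π_i S|` for all `S ⊆ T`.

The excess `|S| - ∑ i, |π_i S|` is largest, for given `|S|`, for sets which fill boxes face by face,
each face in the same way. This is proved by cutting off the smallest slice in a direction in which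
`S` has the largest number of values, and reduces to an inequality between the largest excesses in
dimensions `d` and `d - 1`. The largest excess vanishes for the cube of side `d` and is never
positive for smaller sets; beyond the cube, the next face contributes an excess of dimension
`d - 1`. By induction the excess first becomes positive at `1 + ∑ i ∈ {1, …, d}, i ^ i` points: take
the cube of side `d` and next to it an extremal set of dimension `d - 1`.
-/

section Blocks

/-- Superadditive functions on `ℕ` vanishing at `0`; the bound on the excess of a set of given size
is one of them. -/
structure IsSuperadditive (F : ℕ → ℤ) : Prop where
  map_zero : F 0 = 0
  add_le_map_add : ∀ m n, F m + F n ≤ F (m + n)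

/-- Among the windows `[t, t + h]` of length `h` inside `[0, b]`, none has a larger increment of `F`
than the last one; the inequality is arranged without differences. -/
def IsTopHeavy (F : ℕ → ℤ) (b : ℕ) : Prop :=
  ∀ t h, t + h ≤ b → F (t + h) + F (b - h) ≤ F b + F t

/-- The left end of the `p`-th block when the positive integers after `1` are divided into
consecutive blocks of lengths `φ 0, φ 1, …`; the block is `(blockStart φ p, blockStart φ (p + 1)]`,
so that the point `1` precedes all blocks. -/
def blockStart (φ : ℕ → ℕ) (p : ℕ) : ℕ := 1 + ∑ j ∈ Finset.range p, φ j

/-- The function with value `0` at `0` and `c` at `1` whose increments repeat, on each block, those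
of `F` from `0` on. The truncated subtraction discards the blocks beyond `m`. -/
def blockExtension (φ : ℕ → ℕ) (F : ℕ → ℤ) (c : ℤ) (m : ℕ) : ℤ :=
  if m = 0 then 0 else c + ∑ j ∈ Finset.range m, F (min (m - blockStart φ j) (φ j))

variable {φ : ℕ → ℕ} {F : ℕ → ℤ} {b : ℕ} {c : ℤ}

/-- Laying `b` windows of length `m` one after the other around a cycle of length `b` makes `m`
turns, and each of them has an increment of at least `F m`: superadditivity takes care of those
which do not wrap around, top-heaviness of those which do. -/
theorem IsTopHeavy.mul_le_mul (hS : IsSuperadditive F) (hT : IsTopHeavy F b) {m : ℕ} (hm : m ≤ b) :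
    b * F m ≤ m * F b := by
  rcases b.eq_zero_or_pos with rfl | hb
  · simp [Nat.le_zero.1 hm]
  have windows : ∀ j : ℕ, ∃ k r : ℕ, j * m = k * b + r ∧ r < b ∧ j * F m ≤ k * F b + F r := by
    intro j
    induction j with
    | zero => exact ⟨0, 0, by simp, hb, by simp [hS.map_zero]⟩
    | succ j ih =>
      obtain ⟨k, r, hkr, hr, hF⟩ := ih
      rcases lt_or_ge (r + m) b with hlt | hge
      · refine ⟨k, r + m, by rw [add_one_mul, hkr, add_assoc], hlt, ?_⟩
        have := hS.add_le_map_add r m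
        push_cast
        linarith
      · refine ⟨k + 1, r + m - b, by rw [add_one_mul, add_one_mul, hkr]; omega, by omega, ?_⟩
        have := hT (r + m - b) (b - r) (by omega)
        rw [show r + m - b + (b - r) = m by omega, Nat.sub_sub_self hr.le] at this
        push_cast
        linarith
  obtain ⟨k, r, hkr, hr, hF⟩ := windows b
  obtain rfl : r = 0 := by
    have hdvd : b ∣ k * b + r := hkr ▸ dvd_mul_right b m
    exact Nat.eq_zero_of_dvd_of_lt ((Nat.dvd_add_right (dvd_mul_left b k)).1 hdvd) hr
  obtain rfl : m = k := Nat.eq_of_mul_eq_mul_left hb (by rw [hkr, add_zero, mul_comm])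
  simpa [hS.map_zero] using hF

theorem blockStart_zero (φ : ℕ → ℕ) : blockStart φ 0 = 1 := by simp [blockStart]

theorem blockStart_succ (φ : ℕ → ℕ) (p : ℕ) : blockStart φ (p + 1) = blockStart φ p + φ p := by
  rw [blockStart, blockStart, Finset.sum_range_succ, add_assoc]

theorem blockStart_strictMono (hpos : ∀ p, 0 < φ p) : StrictMono (blockStart φ) :=
  strictMono_nat_of_lt_succ fun p => by
    rw [blockStart_succ]
    exact Nat.lt_add_of_pos_right (hpos p)

theorem lt_blockStart (hpos : ∀ p, 0 < φ p) (p : ℕ) : p < blockStart φ p := by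
  have := (blockStart_strictMono hpos).add_le_nat p 0
  rwa [blockStart_zero, add_zero] at this

theorem blockStart_add_le (hpos : ∀ p, 0 < φ p) {p r : ℕ} (h : p < r) :
    blockStart φ p + φ p ≤ blockStart φ r :=
  blockStart_succ φ p ▸ (blockStart_strictMono hpos).monotone h

theorem exists_eq_blockStart_add (hpos : ∀ p, 0 < φ p) {m : ℕ} (hm : 2 ≤ m) :
    ∃ p s, 0 < s ∧ s ≤ φ p ∧ m = blockStart φ p + s := by
  have hex : ∃ p, m ≤ blockStart φ p := ⟨m, (lt_blockStart hpos m).le⟩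
  obtain ⟨p, hp⟩ : ∃ p, Nat.find hex = p + 1 := by
    refine Nat.exists_eq_succ_of_ne_zero fun h => ?_
    have := Nat.find_spec hex
    rw [h, blockStart_zero] at this
    omega
  have hle := Nat.find_spec hex
  have hlt := Nat.find_min hex (m := p) (by omega)
  rw [hp, blockStart_succ] at hle
  exact ⟨p, m - blockStart φ p, by omega, by omega, by omega⟩

theorem blockExtension_zero : blockExtension φ F c 0 = 0 := if_pos rfl

theorem blockExtension_one (h0 : F 0 = 0) : blockExtension φ F c 1 = c := by
  simp [blockExtension, blockStart_zero, h0]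

theorem blockExtension_blockStart_add_eq_sum (h0 : F 0 = 0) (hpos : ∀ p, 0 < φ p) {p s : ℕ}
    (hs : s ≤ φ p) :
    blockExtension φ F c (blockStart φ p + s) = c + ∑ j ∈ Finset.range p, F (φ j) + F s := by
  have hp := lt_blockStart hpos p
  have full : ∀ j ∈ Finset.range p, F (min (blockStart φ p + s - blockStart φ j) (φ j)) = F (φ j) :=
    fun j hj => by
      have := blockStart_add_le hpos (Finset.mem_range.1 hj)
      rw [min_eq_right (by omega)]
  have beyond : ∀ j ∈ Finset.Ico (p + 1) (blockStart φ p + s),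
      F (min (blockStart φ p + s - blockStart φ j) (φ j)) = 0 := fun j hj => by
    have := blockStart_add_le hpos (Finset.mem_Ico.1 hj).1
    rw [Nat.sub_eq_zero_of_le (by omega), Nat.zero_min, h0]
  rw [blockExtension, if_neg (by omega),
    ← Finset.sum_range_add_sum_Ico _ (show p + 1 ≤ blockStart φ p + s by omega),
    Finset.sum_eq_zero beyond, Finset.sum_range_succ, Finset.sum_congr rfl full,
    Nat.add_sub_cancel_left, min_eq_left hs, add_zero, ← add_assoc]

/-- The hypotheses under which `blockExtension φ F c` inherits superadditivity and top-heaviness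
from `F`. -/
structure IsBlockData (φ : ℕ → ℕ) (F : ℕ → ℤ) (c : ℤ) : Prop where
  superadditive : IsSuperadditive F
  topHeavy : ∀ p, IsTopHeavy F (φ p)
  pos : ∀ p, 0 < φ p
  mono : Monotone φ
  le_map_one : c ≤ F 1

namespace IsBlockData

theorem blockExtension_blockStart_add (H : IsBlockData φ F c) {p s : ℕ} (hs : s ≤ φ p) :
    blockExtension φ F c (blockStart φ p + s) = blockExtension φ F c (blockStart φ p) + F s := by
  have h0 := H.superadditive.map_zero
  have start := blockExtension_blockStart_add_eq_sum (c := c) h0 H.pos (Nat.zero_le (φ p))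
  rw [add_zero, h0, add_zero] at start
  rw [blockExtension_blockStart_add_eq_sum h0 H.pos hs, start]

theorem blockExtension_blockStart_succ (H : IsBlockData φ F c) (p : ℕ) :
    blockExtension φ F c (blockStart φ (p + 1)) =
      blockExtension φ F c (blockStart φ p) + F (φ p) := by
  rw [blockStart_succ, H.blockExtension_blockStart_add le_rfl]

theorem blockExtension_add_le (H : IsBlockData φ F c) {p t h : ℕ} (hh : h ≤ φ p)
    (hth : t + h ≤ blockStart φ (p + 1)) :
    blockExtension φ F c (t + h) + F (φ p - h) ≤ F (φ p) + blockExtension φ F c t := by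
  induction h using Nat.strong_induction_on generalizing t with
  | _ h ih =>
  rcases h.eq_zero_or_pos with rfl | hpos
  · simp [add_comm]
  rcases lt_or_ge (t + h) 2 with hlt | hge
  · obtain ⟨rfl, rfl⟩ : t = 0 ∧ h = 1 := by omega
    have hadd := H.superadditive.add_le_map_add (φ p - 1) 1
    rw [Nat.sub_add_cancel hh] at hadd
    rw [zero_add, blockExtension_one H.superadditive.map_zero, blockExtension_zero]
    linarith [H.le_map_one]
  obtain ⟨r, s, hs0, hs, hr⟩ := exists_eq_blockStart_add H.pos hge
  have hrp : r ≤ p := by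
    by_contra! hpr
    have := (blockStart_strictMono H.pos).monotone (show p + 1 ≤ r from hpr)
    omega
  rw [hr, H.blockExtension_blockStart_add hs]
  rcases lt_or_ge s h with hsh | hsh
  · have hstart : blockStart φ r = t + (h - s) := by omega
    have hrest := ih (h - s) (by omega) (by omega) (t := t) (by omega)
    rw [← hstart] at hrest
    have hadd := H.superadditive.add_le_map_add (φ p - h) s
    rw [show φ p - h + s = φ p - (h - s) by omega] at hadd
    linarith
  · obtain ⟨u, rfl⟩ : ∃ u, s = u + h := ⟨s - h, by omega⟩
    obtain rfl : t = blockStart φ r + u := by omega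
    rw [H.blockExtension_blockStart_add (by omega)]
    linarith [H.topHeavy p u h (hs.trans (H.mono hrp))]

theorem isTopHeavy_blockExtension (H : IsBlockData φ F c) (p : ℕ) :
    IsTopHeavy (blockExtension φ F c) (blockStart φ p) := by
  induction p with
  | zero =>
    intro t h hth
    rw [blockStart_zero] at hth ⊢
    obtain ⟨rfl, rfl⟩ | ⟨rfl, rfl⟩ | ⟨rfl, rfl⟩ :
      (t = 0 ∧ h = 0) ∨ (t = 1 ∧ h = 0) ∨ (t = 0 ∧ h = 1) := by omega
    all_goals simp [add_comm]
  | succ p ih =>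
    intro t h hth
    have hsucc := blockStart_succ φ p
    rcases le_total h (φ p) with hle | hle
    · have hwindow := H.blockExtension_add_le hle hth
      rw [show blockStart φ (p + 1) - h = blockStart φ p + (φ p - h) by omega,
        H.blockExtension_blockStart_add (Nat.sub_le _ _), H.blockExtension_blockStart_succ]
      linarith
    · obtain ⟨g, rfl⟩ := Nat.exists_eq_add_of_le' hle
      have hlast := H.blockExtension_add_le (p := p) (t := t + g) le_rfl (by omega)
      have hfirst := ih t g (by omega)
      rw [Nat.sub_self, H.superadditive.map_zero] at hlast
      rw [show blockStart φ (p + 1) - (g + φ p) = blockStart φ p - g by omega,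
        H.blockExtension_blockStart_succ, ← add_assoc]
      linarith

theorem blockExtension_sub_add_le (H : IsBlockData φ F c) {p s h : ℕ} (hs : s ≤ φ p)
    (hh : h ≤ s ∨ ∃ r, p = r + 1 ∧ h ≤ φ r) :
    blockExtension φ F c (blockStart φ p + s - h) + F h ≤
      blockExtension φ F c (blockStart φ p + s) := by
  rw [H.blockExtension_blockStart_add hs]
  rcases le_or_gt h s with hle | hlt
  · have hadd := H.superadditive.add_le_map_add (s - h) h
    rw [Nat.sub_add_cancel hle] at hadd
    rw [Nat.add_sub_assoc hle, H.blockExtension_blockStart_add (by omega)]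
    linarith
  · obtain ⟨r, rfl, hr⟩ := hh.resolve_left hlt.not_ge
    have hwindow := H.topHeavy r s (h - s) (by omega)
    rw [Nat.add_sub_cancel' hlt.le] at hwindow
    rw [H.blockExtension_blockStart_succ, blockStart_succ,
      show blockStart φ r + φ r + s - h = blockStart φ r + (φ r - (h - s)) by omega,
      H.blockExtension_blockStart_add (Nat.sub_le _ _)]
    linarith

/-- The second summand is taken off in pieces which end at the starts of blocks, the last piece
first; each of them fits into the last block of what is left, or into the block before it. -/
theorem isSuperadditive_blockExtension (H : IsBlockData φ F c) :
    IsSuperadditive (blockExtension φ F c) := by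
  refine ⟨blockExtension_zero, fun m n => ?_⟩
  induction n using Nat.strong_induction_on with
  | _ n ih =>
  rcases m.eq_zero_or_pos with rfl | hm
  · simp [blockExtension_zero]
  rcases n.eq_zero_or_pos with rfl | hn
  · simp [blockExtension_zero]
  obtain ⟨p, s, hs0, hs, hmn⟩ := exists_eq_blockStart_add H.pos (show 2 ≤ m + n by omega)
  rcases lt_or_ge n 2 with hlt | hge
  · obtain rfl : n = 1 := by omega
    have hdel := H.blockExtension_sub_add_le hs (h := 1) (Or.inl hs0)
    rw [← hmn, Nat.add_sub_cancel] at hdel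
    rw [blockExtension_one H.superadditive.map_zero]
    linarith [H.le_map_one]
  · obtain ⟨r, u, hu0, hu, rfl⟩ := exists_eq_blockStart_add H.pos hge
    have hrp : r ≤ p := by
      by_contra! hpr
      have := blockStart_add_le H.pos hpr
      omega
    have hdel := H.blockExtension_sub_add_le hs (h := u) <| by
      rcases hrp.eq_or_lt with rfl | hlt
      · exact Or.inl (by omega)
      · exact Or.inr ⟨p - 1, by omega, hu.trans (H.mono (by omega))⟩
    rw [← hmn, ← add_assoc, Nat.add_sub_cancel] at hdel
    rw [H.blockExtension_blockStart_add hu, ← add_assoc m]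
    linarith [ih (blockStart φ r) (by omega)]

end IsBlockData

end Blocks

section Boxes

/-- The number of points of a box in dimension `d` with `c` sides of length `q + 1` and `d - c`
sides of length `q`. -/
def boxSize (d q c : ℕ) : ℕ := q ^ (d - c) * (q + 1) ^ c

/-- When the sides of a unit box in dimension `d + 1` are increased by one in cyclic order, the
number of points of the `p`-th face, counting from `0`, that is added to the box. -/
def cyclicFace (d p : ℕ) : ℕ := boxSize d (p / (d + 1) + 1) (p % (d + 1))

/-- An upper bound for the excess `|T| - ∑ i, |π_i T|` of a set `T` of `m` points in dimension `d`,
where `π_i` forgets the `i`-th coordinate. It is the excess of a set which fills the boxes of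
`cyclicFace` one after the other, each new face being filled in the same way. -/
def excessBound : ℕ → ℕ → ℤ
  | 0, m => m
  | d + 1, m => blockExtension (cyclicFace d) (excessBound d) (-d) m

variable {d q c : ℕ}

theorem boxSize_zero (d q : ℕ) : boxSize d q 0 = q ^ d := by simp [boxSize]

theorem boxSize_self (d q : ℕ) : boxSize d q d = (q + 1) ^ d := by simp [boxSize]

theorem boxSize_succ_left (q : ℕ) (hc : c ≤ d) :
    boxSize (d + 1) q c = q * boxSize d q c := by
  rw [boxSize, boxSize, Nat.sub_add_comm hc]
  ring

theorem boxSize_succ_succ (d q c : ℕ) :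
    boxSize (d + 1) q (c + 1) = (q + 1) * boxSize d q c := by
  rw [boxSize, boxSize, Nat.add_sub_add_right]
  ring

theorem boxSize_succ_right (q : ℕ) (hc : c ≤ d) :
    boxSize (d + 1) q (c + 1) = boxSize (d + 1) q c + boxSize d q c := by
  rw [boxSize_succ_left q hc, boxSize_succ_succ, add_one_mul]

theorem boxSize_pos (hq : 0 < q) : 0 < boxSize d q c := by
  unfold boxSize
  positivity

theorem boxSize_le_succ_pow (q : ℕ) (hc : c ≤ d) : boxSize d q c ≤ (q + 1) ^ d :=
  calc q ^ (d - c) * (q + 1) ^ c ≤ (q + 1) ^ (d - c) * (q + 1) ^ c := by gcongr; omega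
    _ = (q + 1) ^ d := by rw [← pow_add, Nat.sub_add_cancel hc]

theorem pow_le_boxSize (q : ℕ) (hc : c ≤ d) : q ^ d ≤ boxSize d q c :=
  calc q ^ d = q ^ (d - c) * q ^ c := by rw [← pow_add, Nat.sub_add_cancel hc]
    _ ≤ q ^ (d - c) * (q + 1) ^ c := by gcongr; omega

theorem exists_eq_mul_succ_add (d p : ℕ) : ∃ q c, c ≤ d ∧ p = q * (d + 1) + c :=
  ⟨p / (d + 1), p % (d + 1), Nat.le_of_lt_succ (Nat.mod_lt _ d.succ_pos),
    (Nat.div_add_mod' p (d + 1)).symm⟩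

theorem cyclicFace_mul_add (q : ℕ) (hc : c ≤ d) :
    cyclicFace d (q * (d + 1) + c) = boxSize d (q + 1) c := by
  rw [cyclicFace, Nat.mul_comm, Nat.mul_add_div d.succ_pos, Nat.mul_add_mod,
    Nat.div_eq_of_lt (by omega), Nat.mod_eq_of_lt (by omega), Nat.add_zero]

theorem cyclicFace_pos (d p : ℕ) : 0 < cyclicFace d p := boxSize_pos (Nat.succ_pos _)

theorem cyclicFace_mono (d : ℕ) : Monotone (cyclicFace d) := by
  refine monotone_nat_of_le_succ fun p => ?_
  obtain ⟨q, c, hc, rfl⟩ := exists_eq_mul_succ_add d p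
  rcases hc.lt_or_eq with hlt | rfl
  · obtain ⟨e, rfl⟩ := Nat.exists_eq_add_of_lt hlt
    rw [add_assoc (q * _), cyclicFace_mul_add q hc, cyclicFace_mul_add q hlt,
      boxSize_succ_right _ (Nat.le_add_right c e)]
    exact Nat.le_add_right _ _
  · rw [show q * (c + 1) + c + 1 = (q + 1) * (c + 1) + 0 by ring, cyclicFace_mul_add q le_rfl,
      cyclicFace_mul_add _ c.zero_le, boxSize_self, boxSize_zero]

theorem blockStart_cyclicFace (q : ℕ) (hc : c ≤ d + 1) :
    blockStart (cyclicFace d) (q * (d + 1) + c) = boxSize (d + 1) (q + 1) c := by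
  induction q generalizing c with
  | zero =>
    induction c with
    | zero => simp [blockStart_zero, boxSize_zero]
    | succ c ih =>
      rw [← add_assoc, blockStart_succ, ih (by omega), cyclicFace_mul_add 0 (by omega),
        boxSize_succ_right _ (by omega)]
  | succ q ihq =>
    induction c with
    | zero => rw [add_zero, add_one_mul, ihq le_rfl, boxSize_self, boxSize_zero]
    | succ c ih =>
      rw [← add_assoc, blockStart_succ, ih (by omega), cyclicFace_mul_add (q + 1) (by omega),
        boxSize_succ_right _ (by omega)]

theorem excessBound_zero_left (m : ℕ) : excessBound 0 m = m := by rw [excessBound]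

theorem excessBound_succ (d : ℕ) :
    excessBound (d + 1) = blockExtension (cyclicFace d) (excessBound d) (-d) := by
  ext m
  rw [excessBound]

theorem excessBound_zero_right (d : ℕ) : excessBound d 0 = 0 := by
  cases d with
  | zero => simp [excessBound_zero_left]
  | succ d => rw [excessBound_succ, blockExtension_zero]

theorem excessBound_one (d : ℕ) : excessBound d 1 = 1 - d := by
  cases d with
  | zero => simp [excessBound_zero_left]
  | succ d =>
    rw [excessBound_succ, blockExtension_one (excessBound_zero_right d)]
    push_cast
    ring

theorem isBlockData_cyclicFace (d : ℕ) : IsBlockData (cyclicFace d) (excessBound d) (-d) := by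
  have hone : ∀ d : ℕ, -(d : ℤ) ≤ excessBound d 1 := fun d => by
    rw [excessBound_one]
    linarith
  induction d with
  | zero =>
    refine ⟨⟨excessBound_zero_right 0, fun m n => ?_⟩, fun p t h hth => ?_, cyclicFace_pos 0,
      cyclicFace_mono 0, hone 0⟩
    · simp [excessBound_zero_left]
    · simp only [excessBound_zero_left]
      push_cast [show h ≤ cyclicFace 0 p by omega]
      linarith
  | succ d H =>
    refine ⟨excessBound_succ d ▸ H.isSuperadditive_blockExtension, fun p => ?_,
      cyclicFace_pos (d + 1), cyclicFace_mono (d + 1), hone (d + 1)⟩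
    rw [cyclicFace, ← blockStart_cyclicFace _ (Nat.le_of_lt_succ (Nat.mod_lt p d.succ.succ_pos)),
      excessBound_succ]
    exact H.isTopHeavy_blockExtension _

theorem isTopHeavy_excessBound_boxSize (q : ℕ) (hc : c ≤ d) :
    IsTopHeavy (excessBound d) (boxSize d (q + 1) c) :=
  cyclicFace_mul_add q hc ▸ (isBlockData_cyclicFace d).topHeavy _

theorem excessBound_blockStart_add {p s : ℕ} (hs : s ≤ cyclicFace d p) :
    excessBound (d + 1) (blockStart (cyclicFace d) p + s) =
      excessBound (d + 1) (blockStart (cyclicFace d) p) + excessBound d s := by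
  rw [excessBound_succ, (isBlockData_cyclicFace d).blockExtension_blockStart_add hs]

theorem excessBound_boxSize_add (q : ℕ) (hc : c ≤ d) {s : ℕ} (hs : s ≤ boxSize d (q + 1) c) :
    excessBound (d + 1) (boxSize (d + 1) (q + 1) c + s) =
      excessBound (d + 1) (boxSize (d + 1) (q + 1) c) + excessBound d s := by
  rw [← blockStart_cyclicFace q (by omega),
    excessBound_blockStart_add (by rwa [cyclicFace_mul_add q hc])]

/-- A box has one projection in each direction, smaller than the box by a factor which is the
length of its sides in that direction. -/
theorem excessBound_boxSize (q : ℕ) (hc : c ≤ d) :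
    (excessBound d (boxSize d (q + 1) c) : ℚ) =
      boxSize d (q + 1) c * (1 - (d - c) / (q + 1) - c / (q + 2)) := by
  induction d generalizing q c with
  | zero =>
    obtain rfl := Nat.le_zero.1 hc
    simp [excessBound_zero_left]
  | succ d ihd =>
    have step : ∀ q c : ℕ, c ≤ d →
        (excessBound (d + 1) (boxSize (d + 1) (q + 1) c) : ℚ) =
          boxSize (d + 1) (q + 1) c * (1 - (d + 1 - c) / (q + 1) - c / (q + 2)) →
        (excessBound (d + 1) (boxSize (d + 1) (q + 1) (c + 1)) : ℚ) =
          boxSize (d + 1) (q + 1) (c + 1) * (1 - (d + 1 - (c + 1)) / (q + 1) - (c + 1) / (q + 2)) :=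
      fun q c hc h => by
        have hface := ihd q hc
        rw [boxSize_succ_right _ hc, excessBound_boxSize_add q hc le_rfl]
        push_cast [boxSize_succ_left (q + 1) hc] at h ⊢
        rw [h, hface]
        field_simp
        ring
    push_cast
    induction q generalizing c with
    | zero =>
      induction c with
      | zero => simp [boxSize_zero, excessBound_one]
      | succ c ihc => exact_mod_cast step 0 c (by omega) (ihc (by omega))
    | succ q ihq =>
      induction c with
      | zero =>
        have h := ihq le_rfl
        rw [boxSize_self] at h
        rw [boxSize_zero, h]
        push_cast
        field_simp
        ring
      | succ c ihc => exact_mod_cast step (q + 1) c (by omega) (ihc (by omega))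

theorem excessBound_succ_pow_self (d : ℕ) : excessBound (d + 1) ((d + 1) ^ (d + 1)) = 0 := by
  have h := excessBound_boxSize d (Nat.zero_le (d + 1))
  rw [boxSize_zero] at h
  have hd : (d + 1 : ℚ) / (d + 1) = 1 := div_self (by positivity)
  push_cast at h
  rw [sub_zero, hd, sub_self, zero_div, sub_zero, mul_zero] at h
  exact_mod_cast h

theorem excessBound_nonpos_of_le_pow {m : ℕ} (hm : m ≤ (d + 1) ^ (d + 1)) :
    excessBound (d + 1) m ≤ 0 := by
  have htop := isTopHeavy_excessBound_boxSize d (Nat.zero_le (d + 1))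
  rw [boxSize_zero] at htop
  have h := htop.mul_le_mul (isBlockData_cyclicFace (d + 1)).superadditive hm
  rw [excessBound_succ_pow_self, mul_zero] at h
  exact nonpos_of_mul_nonpos_right h (by positivity)

theorem sum_Icc_pow_self_le (d : ℕ) : ∑ i ∈ Finset.Icc 1 d, i ^ i ≤ (d + 1) ^ d := by
  induction d with
  | zero => simp
  | succ d ih =>
    rw [Finset.sum_Icc_succ_top (by omega)]
    calc ∑ i ∈ Finset.Icc 1 d, i ^ i + (d + 1) ^ (d + 1)
        ≤ (d + 1) ^ d + (d + 1) ^ d * (d + 1) := by gcongr; exact (pow_succ _ _).le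
      _ = (d + 1) ^ d * (d + 1 + 1) := by ring
      _ ≤ (d + 1 + 1) ^ d * (d + 1 + 1) := by gcongr; omega
      _ = (d + 1 + 1) ^ (d + 1) := (pow_succ _ _).symm

theorem excessBound_nonpos {m : ℕ} (hm : m ≤ ∑ i ∈ Finset.Icc 1 d, i ^ i) :
    excessBound d m ≤ 0 := by
  induction d generalizing m with
  | zero =>
    obtain rfl : m = 0 := by simpa using hm
    rw [excessBound_zero_right]
  | succ d ih =>
    rcases le_total m ((d + 1) ^ (d + 1)) with h | h
    · exact excessBound_nonpos_of_le_pow h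
    · obtain ⟨s, rfl⟩ := Nat.exists_eq_add_of_le h
      rw [Finset.sum_Icc_succ_top (by omega)] at hm
      have hs : s ≤ ∑ i ∈ Finset.Icc 1 d, i ^ i := by omega
      have hface : s ≤ boxSize d (d + 1) 0 := boxSize_zero d _ ▸ hs.trans (sum_Icc_pow_self_le d)
      rw [← boxSize_zero, excessBound_boxSize_add d d.zero_le hface, boxSize_zero,
        excessBound_succ_pow_self, zero_add]
      exact ih hs

theorem excessBound_blockStart_add_sub_add_le {p s h : ℕ} (hs : s ≤ cyclicFace d p)
    (hh : h ≤ s ∨ ∃ r, p = r + 1 ∧ h ≤ cyclicFace d r) :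
    excessBound (d + 1) (blockStart (cyclicFace d) p + s - h) + excessBound d h ≤
      excessBound (d + 1) (blockStart (cyclicFace d) p + s) :=
  excessBound_succ d ▸ (isBlockData_cyclicFace d).blockExtension_sub_add_le hs hh

theorem excessBound_pow_add_sub_add_le {q s h : ℕ} (hs : s ≤ (q + 1) ^ d)
    (hh : (q + 2) * h ≤ (q + 1) ^ (d + 1) + s) :
    excessBound (d + 1) ((q + 1) ^ (d + 1) + s - h) + excessBound d h ≤
      excessBound (d + 1) ((q + 1) ^ (d + 1) + s) := by
  have hstart := blockStart_cyclicFace (d := d) q (Nat.zero_le _)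
  have hface := cyclicFace_mul_add (d := d) q (Nat.zero_le _)
  rw [boxSize_zero] at hstart hface
  rw [← hstart]
  refine excessBound_blockStart_add_sub_add_le (hface ▸ hs) ?_
  cases q with
  | zero =>
    simp only [zero_add, one_pow] at hs hh
    exact Or.inl (by omega)
  | succ q =>
    refine Or.inr ⟨q * (d + 1) + d, by ring, ?_⟩
    rw [cyclicFace_mul_add q le_rfl, boxSize_self]
    refine Nat.le_of_mul_le_mul_left (c := q + 1 + 2) ?_ (by omega)
    calc (q + 1 + 2) * h ≤ (q + 1 + 1) ^ (d + 1) + (q + 1 + 1) ^ d := by omega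
      _ = (q + 1 + 2) * (q + 1 + 1) ^ d := by ring

/-- The case in which the removed points exceed both the current face and the one before it: if
there are `t` more of them than in the latter, the inequality reduces to the removal of `t` of the
`s` points one dimension lower. -/
theorem excessBound_boxSize_add_sub_add_le {q s t : ℕ} (hc : c ≤ d)
    (hs : s ≤ boxSize (d + 1) (q + 1) (c + 1)) (hts : t ≤ s)
    (hst : s - t ≤ boxSize (d + 1) (q + 1) c) (ht : t ≤ boxSize d (q + 1) c)
    (hslice : excessBound (d + 1) (s - t) + excessBound d t ≤ excessBound (d + 1) s) :
    excessBound (d + 2) (boxSize (d + 2) (q + 1) (c + 1) + s - (boxSize (d + 1) (q + 1) c + t)) +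
        excessBound (d + 1) (boxSize (d + 1) (q + 1) c + t) ≤
      excessBound (d + 2) (boxSize (d + 2) (q + 1) (c + 1) + s) := by
  rw [excessBound_boxSize_add q (by omega) hs, excessBound_boxSize_add q hc ht,
    boxSize_succ_right _ (by omega), excessBound_boxSize_add q (by omega) le_rfl,
    show boxSize (d + 2) (q + 1) c + boxSize (d + 1) (q + 1) c + s -
      (boxSize (d + 1) (q + 1) c + t) = boxSize (d + 2) (q + 1) c + (s - t) by omega,
    excessBound_boxSize_add q (by omega) hst]
  linarith

theorem excessBound_sub_add_le {m h k : ℕ} (hk : 2 ≤ k) (hm : m ≤ k ^ (d + 1)) (hkm : k * h ≤ m) :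
    excessBound (d + 1) (m - h) + excessBound d h ≤ excessBound (d + 1) m := by
  induction d using Nat.strong_induction_on generalizing m h k with
  | _ d ih =>
  rcases h.eq_zero_or_pos with rfl | hpos
  · simp [excessBound_zero_right]
  have hm2 : 2 ≤ m := by nlinarith
  obtain ⟨p, s, hs0, hs, rfl⟩ := exists_eq_blockStart_add (cyclicFace_pos d) hm2
  by_cases hh : h ≤ s ∨ ∃ r, p = r + 1 ∧ h ≤ cyclicFace d r
  · exact excessBound_blockStart_add_sub_add_le hs hh
  push Not at hh
  obtain ⟨hsh, hprev⟩ := hh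
  obtain ⟨q, c, hc, rfl⟩ := exists_eq_mul_succ_add d p
  rw [cyclicFace_mul_add q hc] at hs
  rw [blockStart_cyclicFace q (by omega)] at hm hkm ⊢
  have hqk : q + 2 ≤ k := by
    by_contra! hlt
    have hbox := pow_le_boxSize (q + 1) (show c ≤ d + 1 by omega)
    have hpow : k ^ (d + 1) ≤ (q + 1) ^ (d + 1) := by gcongr; omega
    omega
  have hqh : (q + 2) * h ≤ boxSize (d + 1) (q + 1) c + s := (Nat.mul_le_mul_right h hqk).trans hkm
  rcases c with _ | c
  · rw [boxSize_zero] at hs hqh ⊢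
    exact excessBound_pow_add_sub_add_le hs hqh
  obtain ⟨d, rfl⟩ : ∃ e, d = e + 1 := ⟨d - 1, by omega⟩
  have hface := hprev (q * (d + 2) + c) rfl
  rw [cyclicFace_mul_add q (by omega)] at hface
  obtain ⟨t, rfl⟩ := Nat.exists_eq_add_of_lt hface
  rw [add_assoc] at hqh ⊢
  have hts : (q + 2) * (t + 1) ≤ s := by
    rw [boxSize_succ_succ] at hqh
    linarith
  have htface : (q + 2) * (t + 1) ≤ (q + 2) * boxSize d (q + 1) c := by
    rw [boxSize_succ_succ] at hs
    linarith
  refine excessBound_boxSize_add_sub_add_le (by omega) hs (by nlinarith) (by omega)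
    (Nat.le_of_mul_le_mul_left htface (by omega)) ?_
  exact ih d (by omega) (k := q + 2) (by omega) (hs.trans (boxSize_le_succ_pow _ hc)) hts

end Boxes

section Projections

/-- The points of `T` agree outside the coordinates in `J`, so that `T` lies in a box of dimension
`J.card`. -/
def IsConstOff {ι α : Type*} (J : Finset ι) (T : Finset (ι → α)) : Prop :=
  ∀ x ∈ T, ∀ y ∈ T, ∀ i ∉ J, x i = y i

theorem IsConstOff.mono {ι α : Type*} {J : Finset ι} {S T : Finset (ι → α)} (hT : IsConstOff J T)
    (h : S ⊆ T) : IsConstOff J S :=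
  fun x hx y hy => hT x (h hx) y (h hy)

theorem IsConstOff.card_le_prod_card_image {ι α : Type*} [DecidableEq α] {J : Finset ι}
    {T : Finset (ι → α)} (hT : IsConstOff J T) : T.card ≤ ∏ i ∈ J, (T.image fun x => x i).card := by
  classical
  rw [← Finset.prod_coe_sort J fun i => (T.image fun x => x i).card, ← Fintype.card_piFinset]
  refine Finset.card_le_card_of_injOn (fun x (j : J) => x j) (fun x hx => ?_)
    fun x hx y hy hxy => ?_
  · exact Fintype.mem_piFinset.2 fun j => Finset.mem_image_of_mem (fun x : ι → α => x j) hx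
  · funext i
    by_cases hi : i ∈ J
    · exact congrFun hxy ⟨i, hi⟩
    · exact hT x hx y hy i hi

/-- The direction is that of the largest number `k` of values, the slice the smallest one. -/
theorem IsConstOff.exists_slice {ι α : Type*} [DecidableEq α] {J : Finset ι}
    {T : Finset (ι → α)} (hT : IsConstOff J T) (h2 : 2 ≤ T.card) :
    ∃ i ∈ J, ∃ a, ∃ k ≥ 2, T.card ≤ k ^ J.card ∧ 0 < {x ∈ T | x i = a}.card ∧
      k * {x ∈ T | x i = a}.card ≤ T.card := by
  have hne : T.Nonempty := Finset.card_pos.1 (by omega)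
  have hJ : J.Nonempty := by
    rw [Finset.nonempty_iff_ne_empty]
    rintro rfl
    have := hT.card_le_prod_card_image
    rw [Finset.prod_empty] at this
    omega
  obtain ⟨i, hi, hmax⟩ := J.exists_max_image (fun i => (T.image fun x => x i).card) hJ
  have hpow := hT.card_le_prod_card_image.trans (Finset.prod_le_pow_card _ _ _ hmax)
  have hk : 2 ≤ (T.image fun x => x i).card := by
    by_contra! hlt
    have := hpow.trans (Nat.pow_le_pow_left (Nat.le_of_lt_succ hlt) J.card)
    rw [one_pow] at this
    omega
  obtain ⟨a, ha, hmin⟩ := (T.image fun x : ι → α => x i).exists_min_image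
    (fun a => {x ∈ T | x i = a}.card) (hne.image _)
  refine ⟨i, hi, a, _, hk, hpow, ?_, ?_⟩
  · obtain ⟨x, hx, hxa⟩ := Finset.mem_image.1 ha
    exact Finset.card_pos.2 ⟨x, Finset.mem_filter.2 ⟨hx, hxa⟩⟩
  · rw [Finset.card_eq_sum_card_image (fun x => x i) T, ← smul_eq_mul]
    exact Finset.card_nsmul_le_sum _ _ _ hmin

variable {ι α : Type*} [DecidableEq ι] [DecidableEq α] [Fintype ι]

/-- The projection of `T` that forgets the coordinate `i`. -/
def coordProj (i : ι) (T : Finset (ι → α)) : Finset ({j // j ≠ i} → α) :=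
  T.image fun x j => x j

/-- The number by which the points of `T` exceed those of its projections in the directions `J`. -/
def excess (J : Finset ι) (T : Finset (ι → α)) : ℤ :=
  T.card - ∑ i ∈ J, ((coordProj i T).card : ℤ)

theorem card_coordProj_union {i j : ι} (hij : i ≠ j) {S T : Finset (ι → α)}
    (h : ∀ x ∈ S, ∀ y ∈ T, x i ≠ y i) :
    (coordProj j (S ∪ T)).card = (coordProj j S).card + (coordProj j T).card := by
  rw [coordProj, Finset.image_union, Finset.card_union_of_disjoint, coordProj, coordProj]
  simp only [Finset.disjoint_left, Finset.mem_image]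
  rintro _ ⟨x, hx, rfl⟩ ⟨y, hy, hxy⟩
  exact h x hx y hy (congrFun hxy ⟨i, hij⟩).symm

theorem excess_insert {i : ι} {J : Finset ι} (hi : i ∉ J) (T : Finset (ι → α)) :
    excess (insert i J) T = excess J T - (coordProj i T).card := by
  rw [excess, excess, Finset.sum_insert hi]
  ring

theorem excess_union {i : ι} {J : Finset ι} (hi : i ∉ J) {S T : Finset (ι → α)}
    (h : ∀ x ∈ S, ∀ y ∈ T, x i ≠ y i) : excess J (S ∪ T) = excess J S + excess J T := by
  have hdisj : Disjoint S T := Finset.disjoint_left.2 fun x hx hx' => h x hx x hx' rfl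
  have hproj : ∀ j ∈ J, ((coordProj j (S ∪ T)).card : ℤ) =
      (coordProj j S).card + (coordProj j T).card := fun j hj => by
    exact_mod_cast card_coordProj_union (ne_of_mem_of_not_mem hj hi).symm h
  rw [excess, excess, excess, Finset.card_union_of_disjoint hdisj, Finset.sum_congr rfl hproj,
    Finset.sum_add_distrib]
  push_cast
  ring

theorem excess_insert_le {i : ι} {J : Finset ι} (hi : i ∉ J) (T : Finset (ι → α)) (a : α) :
    excess (insert i J) T ≤
      excess (insert i J) {x ∈ T | x i ≠ a} + excess J {x ∈ T | x i = a} := by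
  have hsplit : excess J T = excess J {x ∈ T | x i = a} + excess J {x ∈ T | x i ≠ a} := by
    rw [← excess_union hi, Finset.filter_union_filter_not_eq]
    intro x hx y hy hxy
    exact (Finset.mem_filter.1 hy).2 (hxy ▸ (Finset.mem_filter.1 hx).2)
  have hproj : (coordProj i {x ∈ T | x i ≠ a}).card ≤ (coordProj i T).card :=
    Finset.card_le_card (Finset.image_subset_image (Finset.filter_subset _ _))
  rw [excess_insert hi, excess_insert hi, hsplit]
  zify at hproj
  linarith

theorem IsConstOff.excess_le_excessBound {J : Finset ι} {T : Finset (ι → α)}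
    (hT : IsConstOff J T) : excess J T ≤ excessBound J.card T.card := by
  induction T using Finset.strongInduction generalizing J with
  | H T ih =>
  rcases lt_or_ge T.card 2 with hlt | hge
  · rcases Nat.le_one_iff_eq_zero_or_eq_one.1 (Nat.le_of_lt_succ hlt) with h | h
    · obtain rfl := Finset.card_eq_zero.1 h
      simp [excess, coordProj, excessBound_zero_right]
    · obtain ⟨x, rfl⟩ := Finset.card_eq_one.1 h
      simp [excess, coordProj, excessBound_one]
  obtain ⟨i, hi, a, k, hk, hpow, hpos, hmul⟩ := hT.exists_slice hge
  obtain ⟨J, hiJ, rfl⟩ : ∃ J', i ∉ J' ∧ insert i J' = J :=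
    ⟨J.erase i, Finset.notMem_erase i J, Finset.insert_erase hi⟩
  have hcard : {x ∈ T | x i = a}.card + {x ∈ T | x i ≠ a}.card = T.card :=
    Finset.card_filter_add_card_filter_not _
  have hslice : excess J {x ∈ T | x i = a} ≤ excessBound J.card {x ∈ T | x i = a}.card := by
    refine ih _ ((Finset.filter_subset _ _).ssubset_of_ne fun h => ?_) fun x hx y hy j hj => ?_
    · rw [h] at hmul hpos
      nlinarith
    · rw [Finset.mem_filter] at hx hy
      rcases eq_or_ne j i with rfl | hji
      · rw [hx.2, hy.2]
      · exact hT x hx.1 y hy.1 j (by simp [hji, hj])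
  have hrest : excess (insert i J) {x ∈ T | x i ≠ a} ≤
      excessBound (J.card + 1) {x ∈ T | x i ≠ a}.card := by
    rw [← Finset.card_insert_of_notMem hiJ]
    refine ih _ ((Finset.filter_subset _ _).ssubset_of_ne fun h => ?_)
      (hT.mono (Finset.filter_subset _ _))
    rw [h] at hcard
    omega
  rw [Finset.card_insert_of_notMem hiJ] at hpow ⊢
  have hbound := excessBound_sub_add_le hk hpow hmul
  rw [← hcard, Nat.add_sub_cancel_left, hcard] at hbound
  linarith [excess_insert_le hiJ T a]

theorem card_le_sum_card_coordProj {T : Finset (ι → α)}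
    (hT : T.card ≤ ∑ i ∈ Finset.Icc 1 (Fintype.card ι), i ^ i) :
    T.card ≤ ∑ i, (coordProj i T).card := by
  have hconst : IsConstOff Finset.univ T := fun _ _ _ _ i hi => absurd (Finset.mem_univ i) hi
  have h := hconst.excess_le_excessBound.trans (excessBound_nonpos hT)
  rw [excess] at h
  zify
  linarith

end Projections

section Guessing

/-- Some player of a team with one player for each coordinate, who see all coordinates but their
own, can be made to guess correctly whenever the point is known to belong to `T`. -/
def IsGuessable {ι α : Type*} (T : Finset (ι → α)) : Prop :=
  ∃ g : (i : ι) → ({j // j ≠ i} → α) → α, ∀ x ∈ T, ∃ i, g i (fun j => x j) = x i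

variable {ι α : Type*} [DecidableEq ι] [DecidableEq α] [Fintype ι]

/-- Each guess of each player serves at most one point of `T`. -/
theorem IsGuessable.card_le_sum_card_coordProj {T : Finset (ι → α)} (hT : IsGuessable T) :
    T.card ≤ ∑ i, (coordProj i T).card := by
  obtain ⟨g, hg⟩ := hT
  have hcover : T ⊆ Finset.univ.biUnion fun i => {x ∈ T | g i (fun j => x j) = x i} := by
    intro x hx
    obtain ⟨i, hi⟩ := hg x hx
    exact Finset.mem_biUnion.2 ⟨i, Finset.mem_univ i, Finset.mem_filter.2 ⟨hx, hi⟩⟩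
  refine (Finset.card_le_card hcover).trans <| Finset.card_biUnion_le.trans <|
    Finset.sum_le_sum fun i _ => Finset.card_le_card_of_injOn (fun x j => x j) ?_ ?_
  · exact fun x hx => Finset.mem_image_of_mem _ (Finset.mem_filter.1 hx).1
  · intro x hx y hy hxy
    funext j
    rcases eq_or_ne j i with rfl | hj
    · rw [← (Finset.mem_filter.1 hx).2, ← (Finset.mem_filter.1 hy).2]
      exact congrArg (g j) hxy
    · exact congrFun hxy ⟨j, hj⟩

/-- A pair of a direction and a projected point calls for one guess, so guessing amounts to choosing
such a pair injectively for each point of `T`, which Hall's theorem makes possible. -/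
theorem isGuessable_of_forall_card_le [Nonempty α] {T : Finset (ι → α)}
    (hT : ∀ S ⊆ T, S.card ≤ ∑ i, (coordProj i S).card) : IsGuessable T := by
  let guesses (x : T) : Finset (Σ i : ι, {j // j ≠ i} → α) :=
    Finset.univ.image fun i => ⟨i, fun j => x.1 j⟩
  have hall : ∀ S : Finset T, S.card ≤ (S.biUnion guesses).card := fun S => by
    have hS := hT (S.map (Function.Embedding.subtype _)) (Finset.map_subtype_subset S)
    rw [Finset.card_map, ← Finset.card_sigma] at hS
    refine hS.trans (Finset.card_le_card ?_)
    rintro ⟨i, z⟩ hz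
    obtain ⟨x, hx, hxz⟩ := Finset.mem_image.1 (Finset.mem_sigma.1 hz).2
    obtain ⟨y, hy, rfl⟩ := Finset.mem_map.1 hx
    exact Finset.mem_biUnion.2 ⟨y, hy, Finset.mem_image.2
      ⟨i, Finset.mem_univ i, congrArg (Sigma.mk i) hxz⟩⟩
  obtain ⟨e, he, hmem⟩ :=
    (Finset.all_card_le_biUnion_card_iff_exists_injective guesses).1 hall
  refine ⟨fun i z => Function.extend e (fun x : T => x.1 i) (Classical.arbitrary _) ⟨i, z⟩,
    fun x hx => ?_⟩
  obtain ⟨i, -, hi⟩ := Finset.mem_image.1 (hmem ⟨x, hx⟩)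
  refine ⟨i, ?_⟩
  dsimp only at hi ⊢
  rw [hi, he.extend_apply]

theorem isGuessable_of_card_le {ι α : Type*} [Fintype ι] [Nonempty α] {T : Finset (ι → α)}
    (hT : T.card ≤ ∑ i ∈ Finset.Icc 1 (Fintype.card ι), i ^ i) : IsGuessable T := by
  classical
  exact isGuessable_of_forall_card_le fun _ hS =>
    card_le_sum_card_coordProj ((Finset.card_le_card hS).trans hT)

end Guessing

section Cube

variable {ι : Type*} [DecidableEq ι] [Fintype ι] {q : ℕ}

/-- The points which differ from `z` in the coordinates in `J` only and are less than `a` there. -/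
def cube (J : Finset ι) (a : Fin q) (z : ι → Fin q) : Finset (ι → Fin q) :=
  Fintype.piFinset fun j => if j ∈ J then Finset.Iio a else {z j}

theorem mem_cube {J : Finset ι} {a : Fin q} {z x : ι → Fin q} :
    x ∈ cube J a z ↔ (∀ j ∈ J, x j < a) ∧ ∀ j ∉ J, x j = z j := by
  rw [cube, Fintype.mem_piFinset, ← forall_and]
  refine forall_congr' fun j => ?_
  split_ifs with hj <;> simp [hj]

theorem card_cube (J : Finset ι) (a : Fin q) (z : ι → Fin q) :
    (cube J a z).card = (a : ℕ) ^ J.card := by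
  simp [cube, Fintype.card_piFinset, apply_ite Finset.card]

theorem coordProj_piFinset_subset {α : Type*} [DecidableEq α] (i : ι) (s : ι → Finset α) :
    coordProj i (Fintype.piFinset s) ⊆ Fintype.piFinset fun j : {j // j ≠ i} => s j := by
  refine Finset.image_subset_iff.2 fun x hx => Fintype.mem_piFinset.2 fun j => ?_
  exact Fintype.mem_piFinset.1 hx j

theorem card_mul_card_coordProj_piFinset_le {α : Type*} [DecidableEq α] (i : ι)
    (s : ι → Finset α) :
    (s i).card * (coordProj i (Fintype.piFinset s)).card ≤ (Fintype.piFinset s).card :=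
  calc (s i).card * (coordProj i (Fintype.piFinset s)).card
      ≤ (s i).card * (Fintype.piFinset fun j : {j // j ≠ i} => s j).card := by
        gcongr
        exact coordProj_piFinset_subset i s
    _ = (Fintype.piFinset s).card := by
        rw [Fintype.card_piFinset, Fintype.card_piFinset, Fintype.prod_eq_mul_prod_subtype_ne _ i]

theorem excess_cube_nonneg {J : Finset ι} {a : Fin q} (ha : J.card ≤ a) (z : ι → Fin q) :
    0 ≤ excess J (cube J a z) := by
  have hproj : ∀ i ∈ J, J.card * (coordProj i (cube J a z)).card ≤ (cube J a z).card :=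
    fun i hi => by
      refine le_trans ?_ (card_mul_card_coordProj_piFinset_le i _)
      rw [if_pos hi, Fin.card_Iio]
      exact Nat.mul_le_mul_right _ ha
  have hsum : J.card * ∑ i ∈ J, (coordProj i (cube J a z)).card ≤ J.card * (cube J a z).card := by
    rw [Finset.mul_sum, ← smul_eq_mul J.card (cube J a z).card]
    exact Finset.sum_le_card_nsmul _ _ _ hproj
  rw [excess, sub_nonneg]
  rcases J.eq_empty_or_nonempty with rfl | hJ
  · simp
  · exact_mod_cast Nat.le_of_mul_le_mul_left hsum hJ.card_pos

theorem coordProj_subset_coordProj_cube {i : ι} {J : Finset ι} (hi : i ∉ J) {a : Fin q}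
    {z : ι → Fin q} {U : Finset (ι → Fin q)}
    (hU : ∀ x ∈ U, (∀ j ∈ J, x j < a) ∧ ∀ j ∉ J, x j = Function.update z i a j)
    (ha : 0 < (a : ℕ)) : coordProj i U ⊆ coordProj i (cube (insert i J) a z) := by
  refine Finset.image_subset_iff.2 fun x hx => Finset.mem_image.2
    ⟨Function.update x i ⟨0, ha.trans a.isLt⟩, mem_cube.2 ⟨fun j hj => ?_, fun j hj => ?_⟩, ?_⟩
  · rcases eq_or_ne j i with rfl | hji
    · rwa [Function.update_self]
    · rw [Function.update_of_ne hji]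
      exact (hU x hx).1 j (Finset.mem_of_mem_insert_of_ne hj hji)
  · rw [Finset.mem_insert, not_or] at hj
    rw [Function.update_of_ne hj.1, (hU x hx).2 j hj.2, Function.update_of_ne hj.1]
  · funext j
    exact Function.update_of_ne j.2 _ _

/-- The extremal sets: a cube whose sides are as long as its dimension, together with an extremal
set in a hyperplane next to one of its faces. -/
theorem exists_card_eq_and_excess_pos {J : Finset ι} (hJ : J.card < q) (z : ι → Fin q) :
    ∃ T : Finset (ι → Fin q),
      (∀ x ∈ T, (∀ i ∈ J, (x i : ℕ) ≤ J.card) ∧ ∀ i ∉ J, x i = z i) ∧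
      T.card = 1 + ∑ i ∈ Finset.Icc 1 J.card, i ^ i ∧ 0 < excess J T := by
  induction J using Finset.induction_on generalizing z with
  | empty => exact ⟨{z}, by simp, by simp, by simp [excess]⟩
  | insert i J hi ih =>
    rw [Finset.card_insert_of_notMem hi] at hJ ⊢
    set a : Fin q := ⟨J.card + 1, hJ⟩
    obtain ⟨U, hU, hcard, hpos⟩ := ih (by omega) (Function.update z i a)
    have hUi : ∀ x ∈ U, x i = a := fun x hx => by rw [(hU x hx).2 i hi, Function.update_self]
    have hdiff : ∀ x ∈ cube (insert i J) a z, ∀ y ∈ U, x i ≠ y i := fun x hx y hy =>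
      hUi y hy ▸ ((mem_cube.1 hx).1 i (Finset.mem_insert_self i J)).ne
    have hproj : coordProj i (cube (insert i J) a z ∪ U) = coordProj i (cube (insert i J) a z) := by
      rw [coordProj, Finset.image_union]
      exact Finset.union_eq_left.2 <| coordProj_subset_coordProj_cube hi
        (fun x hx => ⟨fun j hj => Nat.lt_succ_of_le ((hU x hx).1 j hj), (hU x hx).2⟩)
        (Nat.succ_pos _)
    refine ⟨cube (insert i J) a z ∪ U, fun x hx => ?_, ?_, ?_⟩
    · rcases Finset.mem_union.1 hx with hxC | hxU
      · exact ⟨fun j hj => ((mem_cube.1 hxC).1 j hj).le, (mem_cube.1 hxC).2⟩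
      · refine ⟨fun j hj => ?_, fun j hj => ?_⟩
        · rcases Finset.mem_insert.1 hj with rfl | hjJ
          · rw [hUi x hxU]
          · exact ((hU x hxU).1 j hjJ).trans (Nat.le_succ _)
        · rw [Finset.mem_insert, not_or] at hj
          rw [(hU x hxU).2 j hj.2, Function.update_of_ne hj.1]
    · have hdisj : Disjoint (cube (insert i J) a z) U :=
        Finset.disjoint_left.2 fun x hx hx' => hdiff x hx x hx' rfl
      rw [Finset.card_union_of_disjoint hdisj, card_cube, hcard,
        Finset.card_insert_of_notMem hi, Finset.sum_Icc_succ_top (by omega)]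
      ring
    · have hcube : 0 ≤ excess (insert i J) (cube (insert i J) a z) :=
        excess_cube_nonneg (Finset.card_insert_of_notMem hi).le z
      rw [excess_insert hi, excess_union hi hdiff, hproj]
      rw [excess_insert hi] at hcube
      linarith

theorem exists_not_isGuessable {ι : Type*} [Fintype ι] (hq : Fintype.card ι < q) :
    ∃ T : Finset (ι → Fin q), T.card = 1 + ∑ i ∈ Finset.Icc 1 (Fintype.card ι), i ^ i ∧
      ¬ IsGuessable T := by
  classical
  obtain ⟨T, -, hcard, hpos⟩ :=
    exists_card_eq_and_excess_pos (J := Finset.univ) hq fun _ : ι => ⟨0, by omega⟩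
  refine ⟨T, hcard, fun hT => ?_⟩
  have := hT.card_le_sum_card_coordProj
  rw [excess] at hpos
  zify at this
  linarith

end Cube

section Book

variable {d n q : ℕ}

theorem inl_mem_neighborSet_inl {i j : Fin d} (h : j ≠ i) :
    Sum.inl j ∈ (bookGraph d n).neighborSet (Sum.inl i) :=
  ⟨fun h' => h (Sum.inl_injective h').symm, Or.inl rfl⟩

theorem inr_mem_neighborSet_inl (i : Fin d) (j : Fin n) :
    Sum.inr j ∈ (bookGraph d n).neighborSet (Sum.inl i) :=
  ⟨Sum.inl_ne_inr, Or.inl rfl⟩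

theorem inl_mem_neighborSet_inr (j : Fin n) (i : Fin d) :
    Sum.inl i ∈ (bookGraph d n).neighborSet (Sum.inr j) :=
  ⟨Sum.inr_ne_inl, Or.inr rfl⟩

/-- If `q` elements escaped all guesses, the answer `a` could be prescribed at the `a`-th of them,
and some page `j`, using a function with these values, would be right at the `y j`-th. -/
theorem card_lt_of_forall_ne {X : Type*} [Nonempty (Fin q)] {g : Fin n → X → Fin q}
    (hg : Function.Surjective g) {y : Fin n → Fin q} {S : Finset X}
    (hS : ∀ x ∈ S, ∀ j, g j x ≠ y j) : S.card < q := by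
  by_contra! hle
  obtain ⟨e⟩ : Nonempty (Fin q ↪ S) :=
    Function.Embedding.nonempty_of_card_le (by simpa using hle)
  have he : Function.Injective fun a => (e a : X) := Subtype.val_injective.comp e.injective
  obtain ⟨j, hj⟩ := hg (Function.invFun fun a => (e a : X))
  refine hS (e (y j)) (e (y j)).2 j ?_
  rw [hj]
  exact Function.leftInverse_invFun he (y j)

theorem hatWinnable_bookGraph_of_isGuessable [Nonempty (Fin q)]
    (hguess : ∀ T : Finset (Fin d → Fin q), T.card < q → IsGuessable T)
    (hn : Fintype.card ((Fin d → Fin q) → Fin q) ≤ n) : HatWinnable (bookGraph d n) q := by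
  classical
  obtain ⟨e⟩ : Nonempty (((Fin d → Fin q) → Fin q) ↪ Fin n) :=
    Function.Embedding.nonempty_of_card_le (by rwa [Fintype.card_fin])
  obtain ⟨g, hg⟩ : ∃ g : Fin n → (Fin d → Fin q) → Fin q, Function.Surjective g :=
    ⟨_, Function.invFun_surjective e.injective⟩
  choose f hf using fun y : Fin n → Fin q =>
    hguess {x | ∀ j, g j x ≠ y j} (card_lt_of_forall_ne hg fun x hx => (Finset.mem_filter.1 hx).2)
  refine ⟨fun v => match v with
    | Sum.inl i => fun c => f (fun j => c ⟨_, inr_mem_neighborSet_inl i j⟩) i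
        fun j => c ⟨_, inl_mem_neighborSet_inl j.2⟩
    | Sum.inr j => fun c => g j fun i => c ⟨_, inl_mem_neighborSet_inr j i⟩, fun c => ?_⟩
  by_cases hpage : ∃ j, g j (fun i => c (Sum.inl i)) = c (Sum.inr j)
  · obtain ⟨j, hj⟩ := hpage
    exact ⟨Sum.inr j, hj⟩
  · push Not at hpage
    obtain ⟨i, hi⟩ := hf (fun j => c (Sum.inr j)) (fun i => c (Sum.inl i))
      (Finset.mem_filter.2 ⟨Finset.mem_univ _, hpage⟩)
    exact ⟨Sum.inl i, hi⟩

/-- Each page can be given a colour which it guesses for no point of `T`; it is then up to the spine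
to guess the points of `T`. -/
theorem isGuessable_of_hatWinnable (h : HatWinnable (bookGraph d n) q) {T : Finset (Fin d → Fin q)}
    (hT : T.card < q) : IsGuessable T := by
  obtain ⟨f, hf⟩ := h
  let b : Fin q := ⟨0, by omega⟩
  have hpage : ∀ j : Fin n, ∃ a, ∀ x ∈ T,
      f (Sum.inr j) (fun w => Sum.elim x (fun _ => b) w.1) ≠ a := fun j => by
    obtain ⟨a, -, ha⟩ := Finset.exists_mem_notMem_of_card_lt_card (t := Finset.univ)
      (s := T.image fun x => f (Sum.inr j) fun w => Sum.elim x (fun _ => b) w.1)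
      (Finset.card_image_le.trans_lt (by rwa [Finset.card_univ, Fintype.card_fin]))
    exact ⟨a, fun x hx hxa => ha (Finset.mem_image.2 ⟨x, hx, hxa⟩)⟩
  choose y hy using hpage
  refine ⟨fun i z => f (Sum.inl i) fun w =>
    Sum.elim (fun j => if h : j = i then b else z ⟨j, h⟩) y w.1, fun x hx => ?_⟩
  obtain ⟨i | j, hv⟩ := hf (Sum.elim x y)
  · refine ⟨i, Eq.trans (congrArg _ (funext ?_)) hv⟩
    rintro ⟨j | j, hj⟩
    · exact dif_neg fun hji => hj.1 (congrArg Sum.inl hji.symm)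
    · rfl
  · refine absurd (Eq.trans (congrArg _ (funext ?_)) hv) (hy j x hx)
    rintro ⟨i | i, hi⟩
    · rfl
    · exact absurd hi.2 (by simp)

theorem le_sum_Icc_pow_self (d : ℕ) : d ≤ ∑ i ∈ Finset.Icc 1 d, i ^ i := by
  calc d = ∑ i ∈ Finset.Icc 1 d, 1 := by simp
    _ ≤ _ := Finset.sum_le_sum fun i hi => Nat.one_le_pow _ _ (Finset.mem_Icc.1 hi).1

theorem hatWinnable_bookGraph
    (hn : Fintype.card ((Fin d → Fin (1 + ∑ i ∈ Finset.Icc 1 d, i ^ i)) →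
      Fin (1 + ∑ i ∈ Finset.Icc 1 d, i ^ i)) ≤ n) :
    HatWinnable (bookGraph d n) (1 + ∑ i ∈ Finset.Icc 1 d, i ^ i) := by
  have : Nonempty (Fin (1 + ∑ i ∈ Finset.Icc 1 d, i ^ i)) := ⟨⟨0, by omega⟩⟩
  refine hatWinnable_bookGraph_of_isGuessable (fun T hT => isGuessable_of_card_le ?_) hn
  rw [Fintype.card_fin]
  omega

theorem le_of_hatWinnable_bookGraph (h : HatWinnable (bookGraph d n) q) :
    q ≤ 1 + ∑ i ∈ Finset.Icc 1 d, i ^ i := by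
  by_contra! hlt
  have hd := le_sum_Icc_pow_self d
  obtain ⟨T, hcard, hT⟩ := exists_not_isGuessable (ι := Fin d) (q := q) (by simp; omega)
  rw [Fintype.card_fin] at hcard
  exact hT (isGuessable_of_hatWinnable h (hcard ▸ hlt))

theorem isVertexCover_range_inl : (bookGraph d n).IsVertexCover (Set.range Sum.inl) := by
  rintro (i | i) (j | j) h
  · exact Or.inl ⟨i, rfl⟩
  · exact Or.inl ⟨i, rfl⟩
  · exact Or.inr ⟨j, rfl⟩
  · exact absurd h.2 (by simp)

theorem vertexCoverNum_bookGraph (hn : 1 ≤ n) : (bookGraph d n).vertexCoverNum = d := by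
  refine le_antisymm ?_ ?_
  · refine isVertexCover_range_inl.vertexCoverNum_le.trans_eq ?_
    rw [← Set.image_univ, Sum.inl_injective.encard_image, Set.encard_univ]
    simp
  · let p : Fin n := ⟨0, hn⟩
    let φ : (⊤ : SimpleGraph (Option (Fin d))) →g bookGraph d n :=
      ⟨fun v => Option.elim v (Sum.inr p) Sum.inl, by
        rintro (_ | i) (_ | j) h
        · exact absurd rfl h
        · exact inl_mem_neighborSet_inr p j
        · exact inr_mem_neighborSet_inl i p
        · exact inl_mem_neighborSet_inl fun hji => h (hji ▸ rfl)⟩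
    have hφ : (⊤ : SimpleGraph (Option (Fin d))).IsContained (bookGraph d n) :=
      ⟨φ, φ.injective_of_top_hom⟩
    have hle := hφ.vertexCoverNum_le_vertexCoverNum
    rw [SimpleGraph.vertexCoverNum_top] at hle
    simpa using hle

end Book

theorem theorem1 (d : ℕ) (hd : 1 ≤ d) :
    ∃ N : ℕ, ∀ n : ℕ, N ≤ n →
      IsHatGuessingNumber (bookGraph d n) (1 + ∑ i ∈ Finset.Icc 1 d, i ^ i) ∧
      (bookGraph d n).vertexCoverNum = d := by
  refine ⟨max 1 (Fintype.card ((Fin d → Fin (1 + ∑ i ∈ Finset.Icc 1 d, i ^ i)) →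
      Fin (1 + ∑ i ∈ Finset.Icc 1 d, i ^ i))), fun n hn => ⟨⟨?_, fun q hq => ?_⟩, ?_⟩⟩
  · exact hatWinnable_bookGraph ((le_max_right _ _).trans hn)
  · exact le_of_hatWinnable_bookGraph hq
  · exact vertexCoverNum_bookGraph ((le_max_left _ _).trans hn)
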